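/- Let $(\Omega,\mathcal F,\mathbb Q)$ be a probability space, $m>0$ and $T>0$. A standard gamma process with growth rate $m$ is a real process $(\gamma_t)_{t\ge 0}$ with independent increments, $\gamma_0=0$ a.s., and, for $t>0$, $\gamma_t$ distributed with density $\mathbf 1_{\{x>0\}}x^{mt-1}e^{-x}/\Gamma(mt)$. A standard gamma bridge over $[0,T]$ with rate $m$ is a process with the same law as $(\gamma_t/\gamma_T)_{0\le t\le T}$ for such a process $\gamma$. Let $X_T$ be a strictly positive integrable random variable with probability density $p$ on $(0,\infty)$, let $(\gamma_{tT})_{0\le t\le T}$ be a standard gamma bridge with rate $m$ that is independent of $X_T$, and set $\xi_t=X_T\gamma_{tT}$ and $\mathcal F_t=\sigma(\xi_s:0\le s\le t)$. Let $P_{tT}$ be a deterministic discount factor and define the reserve $S_t=P_{tT}\,\mathbb E[X_T\mid\mathcal F_t]$. Then, for every $0\le t<T$, almost surely the two integrals below are finite, the denominator is positive, and $$S_t=P_{tT}\,\frac{\int_{\xi_t}^\infty p(x)\,x^{2-mT}(x-\xi_t)^{m(T-t)-1}\,dx}{\int_{\xi_t}^\infty p(x)\,x^{1-mT}(x-\xi_t)^{m(T-t)-1}\,dx}.$$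 Moreover, for every $0\le t<T$, the conditional law of $X_T$ given $\xi_t$, and likewise given $\mathcal F_t$, has the density $$\pi_t(x)=\mathbf 1_{\{x>\xi_t\}}\frac{p(x)\,x^{1-mT}(x-\xi_t)^{m(T-t)-1}}{\int_{\xi_t}^\infty p(z)\,z^{1-mT}(z-\xi_t)^{m(T-t)-1}\,dz},\qquad x>0.$$ -/

import Mathlib

open MeasureTheory ProbabilityTheory Set
open scoped NNReal ENNReal

universe u

/-- A standard gamma process `(γ_t)_{t ≥ 0}` with growth rate `m`: a real process with independent
increments, `γ_0 = 0` almost surely, and, for `t > 0`, `γ_t` gamma distributed with shape `m t`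
and scale `1`. -/
structure IsStandardGammaProcess {Ω : Type u} [MeasurableSpace Ω] (m : ℝ) (γ : ℝ≥0 → Ω → ℝ)
    (Q : Measure Ω) : Prop where
  measurable : ∀ t, Measurable (γ t)
  zero : ∀ᵐ ω ∂Q, γ 0 ω = 0
  indepIncrements : HasIndepIncrements γ Q
  hasLaw : ∀ t : ℝ≥0, 0 < t → HasLaw (γ t) (gammaMeasure (m * t) 1) Q

/-- A standard gamma bridge over `[0, T]` with rate `m`: a real process indexed by `[0, T]` that has
the same law (on the product `σ`-algebra) as `(γ_t / γ_T)_{0 ≤ t ≤ T}` for some standard gamma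
process `γ` with growth rate `m`, possibly living on another probability space.
Here `Set.Iic T` in `ℝ≥0` is the interval `[0, T]`. -/
structure IsStandardGammaBridge {Ω : Type u} [MeasurableSpace Ω] (m : ℝ) (T : ℝ≥0)
    (β : Iic T → Ω → ℝ) (Q : Measure Ω) : Prop where
  measurable : ∀ t, Measurable (β t)
  law : ∃ (Ω' : Type u) (_ : MeasurableSpace Ω') (Q' : Measure Ω') (γ : ℝ≥0 → Ω' → ℝ),
    IsProbabilityMeasure Q' ∧ IsStandardGammaProcess m γ Q' ∧
      IdentDistrib (fun ω (t : Iic T) ↦ β t ω) (fun ω' (t : Iic T) ↦ γ t ω' / γ T ω') Q Q'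

/-- The aggregate claims process `ξ_t = X_T γ_{tT}`. -/
def claimsProcess {Ω : Type u} {T : ℝ≥0} (X : Ω → ℝ) (β : Iic T → Ω → ℝ) (t : Iic T) (ω : Ω) : ℝ :=
  X ω * β t ω

/-- The `σ`-algebra `σ(ξ_s : 0 ≤ s ≤ t)` generated by a process `ξ` up to time `t`. -/
abbrev historySigma {Ω : Type u} {T : ℝ≥0} (ξ : Iic T → Ω → ℝ) (t : Iic T) : MeasurableSpace Ω :=
  ⨆ s : Iic T, ⨆ _ : s ≤ t, MeasurableSpace.comap (ξ s) inferInstance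

/-- The value (reserve) process `S_t = P_{tT} E[X_T | F_t]`, where `F_t` is generated by
`(ξ_s)_{0 ≤ s ≤ t}` and `P s t` is the discount factor from time `t` to time `s`. -/
noncomputable def valueProcess {Ω : Type u} [MeasurableSpace Ω] (Q : Measure Ω) {T : ℝ≥0}
    (P : ℝ≥0 → ℝ≥0 → ℝ) (X : Ω → ℝ) (ξ : Iic T → Ω → ℝ) (t : Iic T) (ω : Ω) : ℝ :=
  P t T * (Q[X | historySigma ξ t]) ω

/-- The function `π_t(x)` of `x`, when `ξ_t = y`. -/
noncomputable def posteriorDensity (m T t : ℝ) (p : ℝ → ℝ) (y x : ℝ) : ℝ :=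
  (Ioi y).indicator
    (fun x ↦ p x * x ^ (1 - m * T) * (x - y) ^ (m * (T - t) - 1) /
      ∫ z in Ioi y, p z * z ^ (1 - m * T) * (z - y) ^ (m * (T - t) - 1)) x

/-! Two facts carry the proof: a Markov-type reduction from the history to the present value, and
Bayes' formula for the present value.

Reduction. For independent gamma variables, `U / (U + V)` is independent of `U + V`
(`map_gammaMeasure_prod_gammaMeasure`). By induction over a finite grid, the ratios `γ_s / γ_t`, `s
≤ t`, are independent of `γ_t`. They are also independent of the later increment, and `γ_T` cancels
in ratios of bridge values, so the same holds for the bridge. Hence finitely many past claims are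
`ξ_s = ξ_t R_s` almost surely, with `R` independent of `(X, ξ_t)` (`exists_indepFun_factorization`).
Such an `R` brings no information on `X`, so conditioning on the history is conditioning on `ξ_t`
(`condExp_iSup_comap_ae_eq`).

Bayes. For `0 < t < T` the bridge value is beta distributed. The change of variable `y = x c` shows
that `(ξ_t, X)` has density `likelihood` with respect to a product `μ ⊗ dx`, all factors depending
on `y` alone being put into `μ`; at `t = 0`, `μ` is a Dirac mass. Normalizing in `x` gives the
posterior density (`condDistrib_ae_eq_withDensity`), and its mean gives the reserve. -/

/-! ### Beta-gamma algebra. -/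

lemma lintegral_eq_mul_lintegral_comp_mul {z : ℝ} (hz : 0 < z) {F : ℝ → ℝ≥0∞}
    (hF : Measurable F) :
    ∫⁻ x, F x = ENNReal.ofReal z * ∫⁻ b, F (z * b) := by
  conv_lhs => rw [← Real.smul_map_volume_mul_left hz.ne']
  rw [lintegral_smul_measure, lintegral_map hF (by fun_prop), abs_of_pos hz, smul_eq_mul]

lemma measurable_gammaPDF (a r : ℝ) : Measurable (gammaPDF a r) :=
  (measurable_gammaPDFReal a r).ennreal_ofReal

lemma measurable_betaPDF (a b : ℝ) : Measurable (betaPDF a b) :=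
  (measurable_betaPDFReal a b).ennreal_ofReal

/-- The factor `z` is the Jacobian of `x = z c`. The endpoints are excluded because `gammaPDF`
follows its power formula at `0`, while `betaPDF` vanishes at `0` and `1`. -/
lemma gammaPDF_mul_gammaPDF_eq {a b z c : ℝ} (ha : 0 < a) (hb : 0 < b) (hz : 0 < z)
    (hc0 : c ≠ 0) (hc1 : c ≠ 1) :
    ENNReal.ofReal z * (gammaPDF a 1 (z * c) * gammaPDF b 1 (z - z * c)) =
      gammaPDF (a + b) 1 z * betaPDF a b c := by
  rcases lt_or_gt_of_ne hc0 with h | h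
  · rw [gammaPDF_of_neg (mul_neg_of_pos_of_neg hz h), betaPDF_eq_zero_of_nonpos h.le]
    simp
  rcases lt_or_gt_of_ne hc1 with h' | h'
  swap
  · rw [gammaPDF_of_neg (x := z - z * c) (by nlinarith), betaPDF_eq_zero_of_one_le h'.le]
    simp
  have h1 : 0 < 1 - c := by linarith
  have h2 : z - z * c = z * (1 - c) := by ring
  rw [betaPDF_of_pos_lt_one h h', gammaPDF_of_nonneg (by positivity),
    gammaPDF_of_nonneg (by rw [h2]; positivity), gammaPDF_of_nonneg hz.le, h2,
    ← ENNReal.ofReal_mul (by positivity), ← ENNReal.ofReal_mul (by positivity),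
    ← ENNReal.ofReal_mul (by positivity)]
  congr 1
  have hG := Real.Gamma_pos_of_pos ha
  have hG' := Real.Gamma_pos_of_pos hb
  have hG'' := Real.Gamma_pos_of_pos (add_pos ha hb)
  have e1 : Real.exp (-(1 * z)) = Real.exp (-(1 * (z * c))) * Real.exp (-(1 * (z * (1 - c)))) := by
    rw [← Real.exp_add]; congr 1; ring
  have e2 : z ^ (a + b - 1) = z * z ^ (a - 1) * z ^ (b - 1) := by
    rw [show a + b - 1 = 1 + (a - 1) + (b - 1) by ring, Real.rpow_add hz, Real.rpow_add hz,
      Real.rpow_one]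
  rw [e1, e2, Real.mul_rpow hz.le h.le, Real.mul_rpow hz.le h1.le, beta]
  simp only [Real.one_rpow]
  field_simp

/-- The beta-gamma algebra: the ratio `U / (U + V)` of independent gamma variables is beta
distributed and independent of the sum `U + V`, which is gamma distributed. -/
lemma map_gammaMeasure_prod_gammaMeasure {a b : ℝ} (ha : 0 < a) (hb : 0 < b) :
    ((gammaMeasure a 1).prod (gammaMeasure b 1)).map (fun z ↦ (z.1 / (z.1 + z.2), z.1 + z.2)) =
      (betaMeasure a b).prod (gammaMeasure (a + b) 1) := by
  have := isProbabilityMeasure_gammaMeasure ha one_pos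
  have := isProbabilityMeasure_gammaMeasure hb one_pos
  have := isProbabilityMeasure_gammaMeasure (add_pos ha hb) one_pos
  have := isProbabilityMeasureBeta ha hb
  have mg (a : ℝ) := measurable_gammaPDF a 1
  have mb := measurable_betaPDF a b
  refine Measure.ext_of_lintegral _ fun f hf ↦ ?_
  have hφ : Measurable (fun z : ℝ × ℝ ↦ (z.1 / (z.1 + z.2), z.1 + z.2)) := by fun_prop
  rw [lintegral_map hf hφ, lintegral_prod _ (by fun_prop), lintegral_prod_symm _ (by fun_prop)]
  have hL : ∫⁻ x, ∫⁻ y, f (x / (x + y), x + y) ∂gammaMeasure b 1 ∂gammaMeasure a 1 =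
      ∫⁻ z, ∫⁻ x, gammaPDF a 1 x * gammaPDF b 1 (z - x) * f (x / z, z) := by
    rw [gammaMeasure, lintegral_withDensity_eq_lintegral_mul _ (mg a)
      (by exact (hf.comp hφ).lintegral_prod_right')]
    rw [lintegral_lintegral_swap (by fun_prop)]
    refine lintegral_congr fun x ↦ ?_
    rw [gammaMeasure, Pi.mul_apply, lintegral_withDensity_eq_lintegral_mul _ (mg b) (by fun_prop),
      ← lintegral_const_mul _ (by fun_prop)]
    -- Translation to the variable `z = x + y`.
    rw [← lintegral_sub_right_eq_self _ x]
    refine lintegral_congr fun z ↦ ?_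
    simp [mul_assoc]
  rw [hL, gammaMeasure, lintegral_withDensity_eq_lintegral_mul _ (mg _)
      (by exact Measurable.lintegral_prod_left' (f := f) hf)]
  refine lintegral_congr_ae ?_
  filter_upwards [Measure.ae_ne volume (0 : ℝ)] with z hz0
  rw [Pi.mul_apply]
  rcases lt_or_gt_of_ne hz0 with hz | hz
  · rw [gammaPDF_of_neg hz, zero_mul, lintegral_eq_zero_iff (by fun_prop)]
    refine ae_of_all _ fun x ↦ ?_
    rcases lt_or_ge x 0 with hx | hx
    · simp [gammaPDF_of_neg hx]
    · simp [gammaPDF_of_neg (show z - x < 0 by linarith)]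
  rw [lintegral_eq_mul_lintegral_comp_mul hz (by fun_prop), ← lintegral_const_mul _ (by fun_prop),
    betaMeasure, lintegral_withDensity_eq_lintegral_mul _ mb (by fun_prop),
    ← lintegral_const_mul _ (by fun_prop)]
  refine lintegral_congr_ae ?_
  filter_upwards [Measure.ae_ne volume (0 : ℝ), Measure.ae_ne volume (1 : ℝ)] with c hc0 hc1
  rw [Pi.mul_apply, ← mul_assoc, gammaPDF_mul_gammaPDF_eq ha hb hz hc0 hc1,
    mul_div_cancel_left₀ _ hz.ne', mul_assoc]

lemma gammaMeasure_conv_gammaMeasure {a b : ℝ} (ha : 0 < a) (hb : 0 < b) :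
    (gammaMeasure a 1).conv (gammaMeasure b 1) = gammaMeasure (a + b) 1 := by
  have := isProbabilityMeasureBeta ha hb
  have := isProbabilityMeasure_gammaMeasure (add_pos ha hb) one_pos
  have h := congrArg Measure.snd (map_gammaMeasure_prod_gammaMeasure ha hb)
  rw [Measure.snd_prod, Measure.snd, Measure.map_map (by fun_prop) (by fun_prop)] at h
  exact h

/-! ### Non-vanishing of the gamma characteristic function. -/

lemma charFun_gammaMeasure_add {a b : ℝ} (ha : 0 < a) (hb : 0 < b) (u : ℝ) :
    charFun (gammaMeasure (a + b) 1) u =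
      charFun (gammaMeasure a 1) u * charFun (gammaMeasure b 1) u := by
  have := isProbabilityMeasure_gammaMeasure ha one_pos
  have := isProbabilityMeasure_gammaMeasure hb one_pos
  rw [← gammaMeasure_conv_gammaMeasure ha hb, charFun_conv]

lemma lintegral_enorm_gammaMeasure {a : ℝ} (ha : 0 < a) :
    ∫⁻ x, ‖x‖ₑ ∂gammaMeasure a 1 = ENNReal.ofReal a := by
  rw [gammaMeasure, lintegral_withDensity_eq_lintegral_mul _ (measurable_gammaPDF a 1)
    (by fun_prop)]
  have h : ∀ᵐ x : ℝ, (gammaPDF a 1 * (enorm : ℝ → ℝ≥0∞)) x =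
      ENNReal.ofReal a * gammaPDF (a + 1) 1 x := by
    filter_upwards [Measure.ae_ne volume (0 : ℝ)] with x hx0
    rcases lt_or_gt_of_ne hx0 with hx | hx
    · simp [gammaPDF_of_neg hx]
    · have hG := Real.Gamma_pos_of_pos ha
      rw [Pi.mul_apply, gammaPDF_of_nonneg hx.le, gammaPDF_of_nonneg hx.le,
        Real.enorm_eq_ofReal hx.le, ← ENNReal.ofReal_mul (by positivity),
        ← ENNReal.ofReal_mul ha.le, Real.Gamma_add_one ha.ne', add_sub_cancel_right,
        Real.rpow_sub_one hx.ne']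
      simp only [Real.one_rpow]
      field_simp
  rw [lintegral_congr_ae h, lintegral_const_mul _ (measurable_gammaPDF _ _),
    lintegral_gammaPDF_eq_one (by linarith) one_pos, mul_one]

/-- At a zero of the characteristic function, `1 = |E(exp(iux) - 1)| ≤ |u| E|x| = |u| a`. -/
lemma one_le_of_charFun_gammaMeasure_eq_zero {a : ℝ} (ha : 0 < a) {u : ℝ}
    (h : charFun (gammaMeasure a 1) u = 0) : 1 ≤ |u| * a := by
  have := isProbabilityMeasure_gammaMeasure ha one_pos
  rw [charFun_apply_real] at h
  have hint : Integrable (fun x : ℝ ↦ Complex.exp (u * x * Complex.I)) (gammaMeasure a 1) := by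
    refine Integrable.of_bound (by fun_prop) 1 (ae_of_all _ fun x ↦ ?_)
    rw [← Complex.ofReal_mul, Complex.norm_exp_ofReal_mul_I]
  have h1 : ∫ x : ℝ, (Complex.exp (u * x * Complex.I) - 1) ∂gammaMeasure a 1 = -1 := by
    rw [integral_sub hint (integrable_const _), h]
    simp
  have h2 : (1 : ℝ≥0∞) ≤ ENNReal.ofReal (|u| * a) :=
    calc (1 : ℝ≥0∞) = ‖∫ x : ℝ, (Complex.exp (u * x * Complex.I) - 1) ∂gammaMeasure a 1‖ₑ := by
          rw [h1]; simp
      _ ≤ ∫⁻ x : ℝ, ‖Complex.exp (u * x * Complex.I) - 1‖ₑ ∂gammaMeasure a 1 :=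
          enorm_integral_le_lintegral_enorm _
      _ ≤ ∫⁻ x : ℝ, ‖u‖ₑ * ‖x‖ₑ ∂gammaMeasure a 1 := by
          refine lintegral_mono fun x ↦ ?_
          rw [← enorm_mul, enorm_le_iff_norm_le]
          have := Real.norm_exp_I_mul_ofReal_sub_one_le (x := u * x)
          rwa [mul_comm, Complex.ofReal_mul] at this
      _ = ENNReal.ofReal (|u| * a) := by
          rw [lintegral_const_mul _ (by fun_prop), lintegral_enorm_gammaMeasure ha,
            ENNReal.ofReal_mul (abs_nonneg u), Real.enorm_eq_ofReal_abs]
  exact ENNReal.one_le_ofReal.1 h2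

/-- By infinite divisibility, a zero for shape `a` is a zero for every shape `a / 2 ^ n`, against
the preceding bound for large `n`. -/
lemma charFun_gammaMeasure_ne_zero {a : ℝ} (ha : 0 < a) (u : ℝ) :
    charFun (gammaMeasure a 1) u ≠ 0 := by
  intro h
  have hn (n : ℕ) : charFun (gammaMeasure (a / 2 ^ n) 1) u = 0 := by
    induction n with
    | zero => simpa using h
    | succ n ih =>
      have hpos : 0 < a / 2 ^ (n + 1) := by positivity
      rw [show a / 2 ^ n = a / 2 ^ (n + 1) + a / 2 ^ (n + 1) by field_simp; ring,
        charFun_gammaMeasure_add hpos hpos] at ih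
      exact mul_self_eq_zero.1 ih
  obtain ⟨n, hn'⟩ := pow_unbounded_of_one_lt (|u| * a) one_lt_two
  have h1 := one_le_of_charFun_gammaMeasure_eq_zero (by positivity) (hn n)
  rw [← mul_div_assoc, le_div_iff₀ (by positivity)] at h1
  linarith

lemma gammaMeasure_absolutelyContinuous (a r : ℝ) : gammaMeasure a r ≪ volume :=
  withDensity_absolutelyContinuous _ _

/-! ### Regrouping independent variables. -/

lemma IndepFun.prodMk_indepFun {Ω α β δ : Type*} [MeasurableSpace Ω] [MeasurableSpace α]
    [MeasurableSpace β] [MeasurableSpace δ] {μ : Measure Ω} [IsProbabilityMeasure μ]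
    {A : Ω → α} {B : Ω → β} {C : Ω → δ} (hA : Measurable A) (hB : Measurable B)
    (hC : Measurable C) (hABC : IndepFun A (fun ω ↦ (B ω, C ω)) μ) (hBC : IndepFun B C μ) :
    IndepFun (fun ω ↦ (A ω, B ω)) C μ := by
  have hAB : IndepFun A B μ := hABC.comp measurable_id measurable_fst
  have := Measure.isProbabilityMeasure_map (μ := μ) hA.aemeasurable
  have := Measure.isProbabilityMeasure_map (μ := μ) hB.aemeasurable
  have := Measure.isProbabilityMeasure_map (μ := μ) hC.aemeasurable
  rw [indepFun_iff_map_prod_eq_prod_map_map (by fun_prop) (by fun_prop)] at *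
  refine MeasurableEquiv.prodAssoc.map_measurableEquiv_injective ?_
  rw [hAB, Measure.prodAssoc_prod, ← hBC, ← hABC, Measure.map_map (by fun_prop) (by fun_prop)]
  rfl

lemma IndepFun.indepFun_prodMk {Ω α β δ : Type*} [MeasurableSpace Ω] [MeasurableSpace α]
    [MeasurableSpace β] [MeasurableSpace δ] {μ : Measure Ω} [IsProbabilityMeasure μ]
    {A : Ω → α} {B : Ω → β} {C : Ω → δ} (hA : Measurable A) (hB : Measurable B)
    (hC : Measurable C) (hABC : IndepFun (fun ω ↦ (A ω, B ω)) C μ) (hAB : IndepFun A B μ) :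
    IndepFun A (fun ω ↦ (B ω, C ω)) μ :=
  (IndepFun.prodMk_indepFun hC hB hA (hABC.symm.comp measurable_id measurable_swap)
    hAB.symm).symm.comp measurable_id measurable_swap

/-! ### Gamma processes: increments and ratios. -/

namespace IsStandardGammaProcess

variable {Ω : Type u} [MeasurableSpace Ω] {Q : Measure Ω} {m : ℝ}
  {γ : ℝ≥0 → Ω → ℝ}

lemma ae_ne_zero (hγ : IsStandardGammaProcess m γ Q) {t : ℝ≥0} (ht : 0 < t) :
    ∀ᵐ ω ∂Q, γ t ω ≠ 0 := by
  have h : ∀ᵐ x ∂Q.map (γ t), x ≠ 0 := by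
    rw [(hγ.hasLaw t ht).map_eq]
    exact (gammaMeasure_absolutelyContinuous _ _).ae_le (Measure.ae_ne volume 0)
  exact ae_of_ae_map (hγ.measurable t).aemeasurable h

lemma indepFun_sub (hγ : IsStandardGammaProcess m γ Q) {s t : ℝ≥0} (hst : s ≤ t) :
    IndepFun (γ s) (γ t - γ s) Q :=
  hγ.indepIncrements.indepFun_eval_sub (zero_le (a := s)) hst hγ.zero

/-- The definition prescribes the laws of the values, not of the increments. The latter follow by
dividing characteristic functions, which is legitimate since that of `γ s` has no zero. -/
lemma map_sub [IsProbabilityMeasure Q] (hγ : IsStandardGammaProcess m γ Q)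
    (hm : 0 < m) {s t : ℝ≥0} (hst : s < t) :
    Q.map (γ t - γ s) = gammaMeasure (m * (t - s)) 1 := by
  have ht : 0 < t := zero_le.trans_lt hst
  have hst' : (0 : ℝ) < t - s := by simpa using hst
  rcases eq_or_ne s 0 with rfl | hs
  · rw [NNReal.coe_zero, sub_zero, ← (hγ.hasLaw t ht).map_eq]
    refine Measure.map_congr ?_
    filter_upwards [hγ.zero] with ω hω
    simp [hω]
  have hs : 0 < s := pos_iff_ne_zero.2 hs
  have hs' : (0 : ℝ) < s := hs
  have := isProbabilityMeasure_gammaMeasure (mul_pos hm hst') one_pos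
  have hms := hγ.measurable s
  have hmt := hγ.measurable t
  refine Measure.ext_of_charFun (funext fun u ↦ ?_)
  have h := congrFun ((hγ.indepFun_sub hst.le).charFun_map_add_eq_mul hms.aemeasurable
    (hmt.sub hms).aemeasurable) u
  rw [Pi.mul_apply, add_sub_cancel, (hγ.hasLaw t ht).map_eq, (hγ.hasLaw s hs).map_eq,
    show m * (t : ℝ) = m * s + m * (t - s) by ring,
    charFun_gammaMeasure_add (mul_pos hm hs') (mul_pos hm hst')] at h
  exact (mul_left_cancel₀ (charFun_gammaMeasure_ne_zero (mul_pos hm hs') u) h).symm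

lemma map_div_prodMk [IsProbabilityMeasure Q] (hγ : IsStandardGammaProcess m γ Q)
    (hm : 0 < m) {s t : ℝ≥0} (hs : 0 < s) (hst : s < t) :
    Q.map (fun ω ↦ (γ s ω / γ t ω, γ t ω)) =
      (betaMeasure (m * s) (m * (t - s))).prod (gammaMeasure (m * t) 1) := by
  have hst' : (0 : ℝ) < t - s := by simpa using hst
  have hs' : (0 : ℝ) < s := hs
  have hms := hγ.measurable s
  have hmt := hγ.measurable t
  have h := (hγ.indepFun_sub hst.le).map_prod_eq_prod_map_map hms.aemeasurable
    (hmt.sub hms).aemeasurable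
  rw [hγ.map_sub hm hst, (hγ.hasLaw s hs).map_eq] at h
  rw [show m * (t : ℝ) = m * s + m * (t - s) by ring,
    ← map_gammaMeasure_prod_gammaMeasure (mul_pos hm hs') (mul_pos hm hst'), ← h,
    Measure.map_map (by fun_prop) (by fun_prop)]
  congr 1
  ext ω <;> simp

lemma indepFun_div [IsProbabilityMeasure Q] (hγ : IsStandardGammaProcess m γ Q)
    (hm : 0 < m) {s t : ℝ≥0} (hst : s < t) :
    IndepFun (fun ω ↦ γ s ω / γ t ω) (γ t) Q := by
  have hms := hγ.measurable s
  have hmt := hγ.measurable t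
  rcases eq_or_ne s 0 with rfl | hs
  · refine (indepFun_const_left (0 : ℝ) (γ t)).congr ?_ .rfl
    filter_upwards [hγ.zero] with ω hω
    simp [hω]
  have hs : 0 < s := pos_iff_ne_zero.2 hs
  have ht : (0 : ℝ) < t := hs.trans hst
  have := isProbabilityMeasureBeta (mul_pos hm (show (0 : ℝ) < s from hs))
    (mul_pos hm (show (0 : ℝ) < t - s by simpa using hst))
  have := isProbabilityMeasure_gammaMeasure (mul_pos hm ht) one_pos
  have h := hγ.map_div_prodMk hm hs hst
  have h1 := congrArg Measure.fst h
  rw [Measure.fst_prod, Measure.fst_map_prodMk hmt] at h1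
  rw [indepFun_iff_map_prod_eq_prod_map_map (by fun_prop) (by fun_prop), h, h1,
    (hγ.hasLaw t (hs.trans hst)).map_eq]

/-- The sampled past consists of partial sums of the increments of index below `n`. Padding by `0`
keeps its type independent of `n`, as the later induction needs. -/
lemma indepFun_past_sub (hγ : IsStandardGammaProcess m γ Q) {τ : ℕ → ℝ≥0} (hτ : Monotone τ)
    (hτ0 : τ 0 = 0) (n : ℕ) :
    IndepFun (fun ω k ↦ if k ≤ n then γ (τ k) ω else 0)
      (fun ω ↦ γ (τ (n + 1)) ω - γ (τ n) ω) Q := by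
  have hD := hγ.indepIncrements.nat hτ
  have hmeas := hγ.measurable
  have hψ : Measurable fun d : ({n} : Finset ℕ) → ℝ ↦ d ⟨n, Finset.mem_singleton_self n⟩ :=
    measurable_pi_apply _
  have h := (hD.indepFun_finset (Finset.range n) {n} (by simp) (fun i ↦ by fun_prop)).comp
    (φ := fun d k ↦ if k ≤ n then ∑ i : Finset.range n, if (i : ℕ) < k then d i else 0 else 0)
    (by
      refine measurable_pi_lambda _ fun k ↦ ?_
      split_ifs
      · refine Finset.measurable_sum _ fun i _ ↦ ?_
        split_ifs <;> fun_prop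
      · fun_prop) hψ
  refine h.congr ?_ .rfl
  filter_upwards [hγ.zero] with ω hω
  funext k
  simp only [Function.comp_apply]
  split_ifs with hk
  · rw [Finset.univ_eq_attach, Finset.sum_attach (Finset.range n)
      (fun i ↦ if i < k then γ (τ (i + 1)) ω - γ (τ i) ω else 0), ← Finset.sum_filter,
      show (Finset.range n).filter (· < k) = Finset.range k by ext i; simp; omega,
      Finset.sum_range_sub (fun i ↦ γ (τ i) ω), hτ0, hω, sub_zero]
  · rfl

lemma indepFun_ratios_prodMk_sub (hγ : IsStandardGammaProcess m γ Q) {τ : ℕ → ℝ≥0}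
    (hτ : Monotone τ) (hτ0 : τ 0 = 0) (n : ℕ) :
    IndepFun (fun ω ↦ ((fun k ↦ if k ≤ n then γ (τ k) ω / γ (τ n) ω else 0 : ℕ → ℝ), γ (τ n) ω))
      (fun ω ↦ γ (τ (n + 1)) ω - γ (τ n) ω) Q := by
  have hφ : Measurable
      fun x : ℕ → ℝ ↦ ((fun k ↦ if k ≤ n then x k / x n else 0 : ℕ → ℝ), x n) := by
    refine Measurable.prodMk (measurable_pi_lambda _ fun k ↦ ?_) (measurable_pi_apply n)
    split_ifs <;> fun_prop
  refine ((hγ.indepFun_past_sub hτ hτ0 n).comp hφ measurable_id).congr (ae_of_all _ fun ω ↦ ?_) .rfl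
  simp only [Function.comp_apply, le_refl, if_true, Prod.mk.injEq, and_true]
  funext k
  split_ifs <;> rfl

/-- The normalized past of a gamma process, sampled at finitely many times, is independent of the
present value. -/
lemma indepFun_ratios [IsProbabilityMeasure Q] (hγ : IsStandardGammaProcess m γ Q)
    (hm : 0 < m) {τ : ℕ → ℝ≥0} (hτ : Monotone τ) (hτ0 : τ 0 = 0) {N : ℕ}
    (hτN : ∀ n < N, τ n < τ (n + 1)) {n : ℕ} (hn : n ≤ N) :
    IndepFun (fun ω k ↦ if k ≤ n then γ (τ k) ω / γ (τ n) ω else 0) (γ (τ n)) Q := by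
  have hmeas := hγ.measurable
  have hR (n : ℕ) :
      Measurable (fun ω (k : ℕ) ↦ if k ≤ n then γ (τ k) ω / γ (τ n) ω else 0) := by
    refine measurable_pi_lambda _ fun k ↦ ?_
    split_ifs <;> fun_prop
  induction n with
  | zero =>
    refine (indepFun_const_right _ (0 : ℝ)).congr .rfl ?_
    filter_upwards [hγ.zero] with ω hω
    rw [hτ0, hω]
  | succ n ih =>
    have hlt := hτN n (by omega)
    -- The old ratios are independent of `γ (τ n)` and the next increment jointly, hence of `(γ (τ
    -- n) / γ (τ (n + 1)), γ (τ (n + 1)))`. These last two are independent of each other, so the old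
    -- ratios together with the new one are independent of `γ (τ (n + 1))`.
    have h1 := hγ.indepFun_ratios_prodMk_sub hτ hτ0 n
    have h2 := (IndepFun.indepFun_prodMk (hR n) (hmeas _) (by fun_prop) h1 (ih (by omega))).comp
      (φ := id) (ψ := fun z : ℝ × ℝ ↦ (z.1 / (z.1 + z.2), z.1 + z.2)) measurable_id (by fun_prop)
    have h3 : IndepFun (fun ω (k : ℕ) ↦ if k ≤ n then γ (τ k) ω / γ (τ n) ω else 0)
        (fun ω ↦ (γ (τ n) ω / γ (τ (n + 1)) ω, γ (τ (n + 1)) ω)) Q :=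
      h2.congr .rfl (ae_of_all _ fun ω ↦ by simp)
    have h4 := (IndepFun.prodMk_indepFun (hR n) (by fun_prop) (by fun_prop) h3
      (hγ.indepFun_div hm hlt)).comp
      (φ := fun z : (ℕ → ℝ) × ℝ ↦ (fun k ↦ if k ≤ n then z.1 k * z.2 else
        if k = n + 1 then 1 else 0 : ℕ → ℝ)) (ψ := id) (by
          refine measurable_pi_lambda _ fun k ↦ ?_
          split_ifs <;> fun_prop) measurable_id
    refine h4.congr ?_ .rfl
    -- At time `0` the ratios are `0 / 0 = 0`; the product of successive ratios is still right
    -- because the numerators vanish too.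
    have hzero : ∀ᵐ ω ∂Q, γ (τ n) ω = 0 → ∀ k ≤ n, γ (τ k) ω = 0 := by
      rcases eq_or_ne (τ n) 0 with h0 | h0
      · filter_upwards [hγ.zero] with ω hω _ k hk
        rw [show τ k = 0 from le_antisymm (h0 ▸ hτ hk) zero_le, hω]
      · filter_upwards [hγ.ae_ne_zero (pos_iff_ne_zero.2 h0)] with ω hω h
        exact absurd h hω
    filter_upwards [hzero, hγ.ae_ne_zero (zero_le.trans_lt hlt)] with ω hω hω'
    funext k
    simp only [Function.comp_apply]
    rcases lt_trichotomy k (n + 1) with hk | rfl | hk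
    · rw [if_pos (by omega), if_pos (by omega), if_pos (by omega)]
      rcases eq_or_ne (γ (τ n) ω) 0 with h0 | h0
      · simp [h0, hω h0 k (by omega)]
      · field_simp
    · simp [div_self hω']
    · rw [if_neg (by omega), if_neg (by omega), if_neg (by omega)]

end IsStandardGammaProcess

/-! ### Gamma bridges: marginal laws and ratios. -/

namespace IsStandardGammaBridge

variable {Ω : Type u} [MeasurableSpace Ω] {Q : Measure Ω} {m : ℝ}
  {T : ℝ≥0} {β : Iic T → Ω → ℝ}

lemma ae_eq_zero (hβ : IsStandardGammaBridge m T β Q) {t : Iic T} (ht : (t : ℝ≥0) = 0) :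
    ∀ᵐ ω ∂Q, β t ω = 0 := by
  obtain ⟨Ω', _, Q', γ, _, hγ, hid⟩ := hβ.law
  have h := hid.comp (u := fun x ↦ x t) (by fun_prop)
  refine h.symm.ae_snd (p := fun x ↦ x = 0) (measurableSet_singleton 0) ?_
  filter_upwards [hγ.zero] with ω hω
  simp [ht, hω]

lemma map_eq_betaMeasure (hβ : IsStandardGammaBridge m T β Q) (hm : 0 < m) {t : Iic T}
    (ht0 : (0 : ℝ≥0) < t) (ht : (t : ℝ≥0) < T) :
    Q.map (β t) = betaMeasure (m * t) (m * (T - t)) := by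
  obtain ⟨Ω', _, Q', γ, _, hγ, hid⟩ := hβ.law
  have h := hid.comp (u := fun x ↦ x t) (by fun_prop)
  have h1 := congrArg Measure.fst (hγ.map_div_prodMk hm ht0 ht)
  have := isProbabilityMeasureBeta (mul_pos hm (show (0 : ℝ) < t from ht0))
    (mul_pos hm (show (0 : ℝ) < T - t by simpa using ht))
  have := isProbabilityMeasure_gammaMeasure (mul_pos hm (show (0 : ℝ) < T from ht0.trans ht))
    one_pos
  rw [Measure.fst_prod, Measure.fst_map_prodMk (hγ.measurable T)] at h1
  exact h.map_eq.trans h1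

lemma ae_ne_zero (hβ : IsStandardGammaBridge m T β Q) (hm : 0 < m) {t : Iic T}
    (ht0 : (0 : ℝ≥0) < t) (ht : (t : ℝ≥0) < T) : ∀ᵐ ω ∂Q, β t ω ≠ 0 := by
  have h : ∀ᵐ x ∂Q.map (β t), x ≠ 0 := by
    rw [hβ.map_eq_betaMeasure hm ht0 ht]
    exact (withDensity_absolutelyContinuous _ _).ae_le (Measure.ae_ne volume 0)
  exact ae_of_ae_map (hβ.measurable t).aemeasurable h

/-- The normalized past of a gamma bridge, sampled at finitely many times, is independent of the
present value. -/
lemma indepFun_ratios [IsProbabilityMeasure Q] (hβ : IsStandardGammaBridge m T β Q)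
    (hm : 0 < m) (hT : 0 < T)
    {τ : ℕ → Iic T}
    (hτ : Monotone τ) (hτ0 : (τ 0 : ℝ≥0) = 0) {n : ℕ} (hτn : ∀ k < n, τ k < τ (k + 1)) :
    IndepFun (fun ω k ↦ if k ≤ n then β (τ k) ω / β (τ n) ω else 0) (β (τ n)) Q := by
  obtain ⟨Ω', _, Q', γ, _, hγ, hid⟩ := hβ.law
  have hmeas := hγ.measurable
  -- The grid jumps to `T` after `n`, so that the increment following `τ n` is `γ T - γ (τ n)`.
  let σ : ℕ → ℝ≥0 := fun k ↦ if k ≤ n then τ k else T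
  have hσ : Monotone σ := monotone_nat_of_le_succ fun k ↦ by
    simp only [σ]
    split_ifs with h1 h2 h2
    · exact_mod_cast hτ (Nat.le_succ k)
    · exact (τ k).2
    · omega
    · exact le_rfl
  have hσ0 : σ 0 = 0 := by simp [σ, hτ0]
  have hσn : σ n = τ n := by simp [σ]
  have hσn' : ∀ k < n, σ k < σ (k + 1) := fun k hk ↦ by
    simpa [σ, show k ≤ n by omega, show k + 1 ≤ n by omega] using hτn k hk
  have hR : Measurable (fun ω (k : ℕ) ↦ if k ≤ n then γ (σ k) ω / γ (σ n) ω else 0) := by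
    refine measurable_pi_lambda _ fun k ↦ ?_
    split_ifs <;> fun_prop
  have h1 := hγ.indepFun_ratios hm hσ hσ0 hσn' le_rfl
  have h2 : IndepFun (fun ω ↦ ((fun k ↦ if k ≤ n then γ (σ k) ω / γ (σ n) ω else 0 : ℕ → ℝ),
      γ (σ n) ω)) (fun ω ↦ γ T ω - γ (σ n) ω) Q' :=
    (hγ.indepFun_ratios_prodMk_sub hσ hσ0 n).congr .rfl (ae_of_all _ fun ω ↦ by simp [σ])
  have h3 := (IndepFun.indepFun_prodMk hR (hmeas _) (by fun_prop) h2 h1).comp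
    (φ := id) (ψ := fun z : ℝ × ℝ ↦ z.1 / (z.1 + z.2)) measurable_id (by fun_prop)
  let F : (Iic T → ℝ) → (ℕ → ℝ) := fun x k ↦ if k ≤ n then x (τ k) / x (τ n) else 0
  have hF : Measurable F := by
    refine measurable_pi_lambda _ fun k ↦ ?_
    simp only [F]
    split_ifs <;> fun_prop
  -- The factor `γ T` cancels in ratios of bridge values. The independence is then transferred to
  -- `β`, being a property of the law only.
  have h4 : IndepFun (fun ω ↦ F (fun t ↦ γ t ω / γ T ω)) (fun ω ↦ γ (τ n) ω / γ T ω) Q' := by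
    refine h3.congr ?_ (ae_of_all _ fun ω ↦ by simp [hσn])
    filter_upwards [hγ.ae_ne_zero hT] with ω hω
    funext k
    simp only [Function.comp_apply, id, F]
    split_ifs with hk
    · simp only [σ, hk, if_true, le_refl]
      rw [div_div_div_cancel_right₀ hω]
    · rfl
  have e1 : IdentDistrib (fun ω ↦ (F (fun t ↦ β t ω), β (τ n) ω))
      (fun ω ↦ (F (fun t ↦ γ t ω / γ T ω), γ (τ n) ω / γ T ω)) Q Q' :=
    hid.comp (u := fun x ↦ (F x, x (τ n))) (by fun_prop)
  have hβm : Measurable (fun ω t ↦ β t ω) := measurable_pi_lambda _ hβ.measurable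
  have hγm : Measurable (fun ω (t : Iic T) ↦ γ t ω / γ T ω) :=
    measurable_pi_lambda _ fun t ↦ by fun_prop
  have e2 := congrArg Measure.fst e1.map_eq
  have e3 := congrArg Measure.snd e1.map_eq
  rw [Measure.fst_map_prodMk (hβ.measurable _), Measure.fst_map_prodMk (by fun_prop)] at e2
  rw [Measure.snd_map_prodMk (by exact hF.comp hβm),
    Measure.snd_map_prodMk (by exact hF.comp hγm)] at e3
  change IndepFun (fun ω ↦ F (fun t ↦ β t ω)) (β (τ n)) Q
  rw [indepFun_iff_map_prod_eq_prod_map_map (by exact (hF.comp hβm).aemeasurable)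
    (hβ.measurable _).aemeasurable, e1.map_eq, e2, e3]
  exact h4.map_prod_eq_prod_map_map (hF.comp hγm).aemeasurable (by fun_prop)

end IsStandardGammaBridge

/-! ### Bayes' formula for a density with respect to a product measure. -/

section Bayes

variable {Ω : Type*} [MeasurableSpace Ω] {Q : Measure Ω}
  {α : Type*} [MeasurableSpace α] {X : Ω → ℝ} {Y : Ω → α} {μ : Measure α}
  {ν : Measure ℝ} [SFinite ν] {k : α → ℝ → ℝ≥0∞}

lemma map_eq_withDensity_of_map_prodMk [SFinite μ] (hX : Measurable X)
    (hk : Measurable (Function.uncurry k))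
    (h : Q.map (fun ω ↦ (Y ω, X ω)) = (μ.prod ν).withDensity (Function.uncurry k)) :
    Q.map Y = μ.withDensity (fun y ↦ ∫⁻ x, k y x ∂ν) := by
  rw [← Measure.fst_map_prodMk hX, h]
  ext s hs
  rw [Measure.fst_apply hs, withDensity_apply _ (measurable_fst hs), withDensity_apply _ hs,
    ← prod_univ, ← Measure.prod_restrict, lintegral_prod _ hk.aemeasurable, Measure.restrict_univ]
  rfl

lemma ae_lintegral_mul_lt_top_of_map_prodMk (hX : Measurable X) (hY : Measurable Y)
    (hk : Measurable (Function.uncurry k))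
    (h : Q.map (fun ω ↦ (Y ω, X ω)) = (μ.prod ν).withDensity (Function.uncurry k))
    {f : ℝ → ℝ≥0∞} (hf : Measurable f) (hfX : ∫⁻ ω, f (X ω) ∂Q ≠ ∞) :
    ∀ᵐ y ∂μ, ∫⁻ x, k y x * f x ∂ν < ∞ := by
  have hk' : Measurable fun z : α × ℝ ↦ k z.1 z.2 := hk
  have h1 : ∫⁻ ω, f (X ω) ∂Q = ∫⁻ y, ∫⁻ x, k y x * f x ∂ν ∂μ := by
    rw [← lintegral_map (f := fun z : α × ℝ ↦ f z.2) (g := fun ω ↦ (Y ω, X ω)) (by fun_prop)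
      (by fun_prop), h, lintegral_withDensity_eq_lintegral_mul _ hk (by fun_prop),
      lintegral_prod _ (by fun_prop)]
    rfl
  exact ae_lt_top (Measurable.lintegral_prod_right' (f := fun z : α × ℝ ↦ k z.1 z.2 * f z.2)
    (by fun_prop)) (h1 ▸ hfX)

lemma absolutelyContinuous_of_map_prodMk [SFinite μ] (hX : Measurable X)
    (hk : Measurable (Function.uncurry k))
    (h : Q.map (fun ω ↦ (Y ω, X ω)) = (μ.prod ν).withDensity (Function.uncurry k)) :
    Q.map Y ≪ μ := by
  rw [map_eq_withDensity_of_map_prodMk hX hk h]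
  exact withDensity_absolutelyContinuous _ _

/-- The normalizing constant is itself the density of the law of `Y` with respect to `μ`, and a
density is almost surely nonzero under its own law. -/
lemma ae_pos_of_map_prodMk [SFinite μ] (hX : Measurable X) (hY : Measurable Y)
    (hk : Measurable (Function.uncurry k))
    (h : Q.map (fun ω ↦ (Y ω, X ω)) = (μ.prod ν).withDensity (Function.uncurry k)) :
    ∀ᵐ ω ∂Q, ∫⁻ x, k (Y ω) x ∂ν ≠ 0 := by
  have hZ : Measurable fun y ↦ ∫⁻ x, k y x ∂ν := hk.lintegral_prod_right'
  have h1 : ∀ᵐ y ∂Q.map Y, ∫⁻ x, k y x ∂ν ≠ 0 := by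
    rw [map_eq_withDensity_of_map_prodMk hX hk h, ae_withDensity_iff hZ]
    exact ae_of_all _ fun y hy ↦ hy
  exact ae_of_ae_map hY.aemeasurable h1

/-- Bayes' formula for densities with respect to a product measure. -/
lemma condDistrib_ae_eq_withDensity [IsProbabilityMeasure Q] [SFinite μ]
    (hX : Measurable X) (hY : Measurable Y)
    (hk : Measurable (Function.uncurry k))
    (h : Q.map (fun ω ↦ (Y ω, X ω)) = (μ.prod ν).withDensity (Function.uncurry k)) :
    ∀ᵐ ω ∂Q, condDistrib X Y Q (Y ω) =
      ν.withDensity (fun x ↦ (∫⁻ x, k (Y ω) x ∂ν)⁻¹ * k (Y ω) x) := by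
  set Z : α → ℝ≥0∞ := fun y ↦ ∫⁻ x, k y x ∂ν
  have hk' : Measurable fun z : α × ℝ ↦ k z.1 z.2 := hk
  have hZ : Measurable Z := hk.lintegral_prod_right'
  have hYlaw := map_eq_withDensity_of_map_prodMk hX hk h
  have hZtop : ∀ᵐ y ∂μ, Z y < ∞ := by
    simpa using ae_lintegral_mul_lt_top_of_map_prodMk hX hY hk h (f := 1) (by fun_prop) (by simp)
  have hd : Measurable (Function.uncurry fun y x ↦ (Z y)⁻¹ * k y x) := by
    change Measurable fun z : α × ℝ ↦ (Z z.1)⁻¹ * k z.1 z.2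
    fun_prop
  let κ : Kernel α ℝ := (Kernel.const α ν).withDensity (fun y x ↦ (Z y)⁻¹ * k y x)
  have hκ (y : α) : κ y = ν.withDensity (fun x ↦ (Z y)⁻¹ * k y x) := by
    rw [Kernel.withDensity_apply _ hd, Kernel.const_apply]
  -- The total mass `(Z y)⁻¹ * Z y` is at most `1` even when `Z y` is `0` or `∞`.
  have hfin : IsFiniteKernel κ := ⟨1, ENNReal.one_lt_top, fun y ↦ by
    rw [hκ, withDensity_apply _ .univ, Measure.restrict_univ,
      lintegral_const_mul _ (by exact hk.of_uncurry_left)]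
    exact ENNReal.inv_mul_le_one _⟩
  have hcomp : Q.map (fun ω ↦ (Y ω, X ω)) = Q.map Y ⊗ₘ κ := by
    have : IsProbabilityMeasure (Q.map Y) := Measure.isProbabilityMeasure_map hY.aemeasurable
    rw [Measure.compProd_withDensity hd, Measure.compProd_const, hYlaw, h,
      prod_withDensity_left hZ, ← withDensity_mul _ (by fun_prop) (by exact hd)]
    refine withDensity_congr_ae ?_
    refine (Measure.ae_prod_iff_ae_ae ?_).2 ?_
    · exact measurableSet_eq_fun (by exact hk) (by
        change Measurable fun z : α × ℝ ↦ Z z.1 * ((Z z.1)⁻¹ * k z.1 z.2)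
        fun_prop)
    -- It remains to check `Z * (Z⁻¹ * k) = k`. If `Z y = 0` then `k y` vanishes almost everywhere;
    -- `Z y = ∞` is excluded for almost every `y`.
    filter_upwards [hZtop] with y hy
    rcases eq_or_ne (Z y) 0 with h0 | h0
    · have := (lintegral_eq_zero_iff (by exact hk.of_uncurry_left)).1 h0
      filter_upwards [this] with x hx
      have hx : k y x = 0 := hx
      simp [Function.uncurry, hx]
    · refine ae_of_all _ fun x ↦ ?_
      simp [Function.uncurry, ← mul_assoc, ENNReal.mul_inv_cancel h0 hy.ne]
  filter_upwards [ae_of_ae_map hY.aemeasurable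
    (condDistrib_ae_eq_of_measure_eq_compProd Y hX.aemeasurable hcomp)] with ω hω
  rw [hω, hκ]

end Bayes

/-! ### From conditioning on the history to conditioning on the present. -/

section CondExp

variable {Ω : Type*} [mΩ : MeasurableSpace Ω] {Q : Measure Ω} [IsProbabilityMeasure Q]
  {X Y : Ω → ℝ} {f : ℝ → ℝ}

/-- By Fubini one may freeze `R = r`. The section of `C` at `r` then defines an event in `σ(Y)`, on
which the identity is the defining property of conditional expectation given `Y`. -/
lemma setIntegral_integral_condDistrib_of_indepFun {E : Type*} [MeasurableSpace E] {R : Ω → E}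
    (hX : Measurable X) (hY : Measurable Y) (hR : Measurable R)
    (hind : IndepFun (fun ω ↦ (X ω, Y ω)) R Q) (hf : StronglyMeasurable f)
    (hfX : Integrable (fun ω ↦ f (X ω)) Q) {C : Set (ℝ × E)} (hC : MeasurableSet C) :
    ∫ ω in {ω | (Y ω, R ω) ∈ C}, ∫ x, f x ∂condDistrib X Y Q (Y ω) ∂Q =
      ∫ ω in {ω | (Y ω, R ω) ∈ C}, f (X ω) ∂Q := by
  set w : ℝ → ℝ := fun y ↦ ∫ x, f x ∂condDistrib X Y Q y
  have hwm : StronglyMeasurable w :=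
    (hf.comp_measurable measurable_snd).integral_condDistrib
  have hce := condExp_ae_eq_integral_condDistrib hY hX.aemeasurable hf hfX
  have hwY : Integrable (fun ω ↦ w (Y ω)) Q := integrable_condExp.congr hce
  have hzero {D : Set ℝ} (hD : MeasurableSet D) :
      ∫ ω in Y ⁻¹' D, (w (Y ω) - f (X ω)) ∂Q = 0 := by
    rw [integral_sub hwY.integrableOn hfX.integrableOn, sub_eq_zero,
      ← setIntegral_condExp hY.comap_le hfX ⟨D, hD, rfl⟩]
    exact setIntegral_congr_ae (hY hD) (hce.mono fun ω hω _ ↦ hω.symm)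
  have hmeasA : MeasurableSet {ω | (Y ω, R ω) ∈ C} := (hY.prodMk hR) hC
  rw [← sub_eq_zero, ← integral_sub hwY.integrableOn hfX.integrableOn,
    ← integral_indicator hmeasA]
  let F : (ℝ × ℝ) × E → ℝ := {z | (z.1.2, z.2) ∈ C}.indicator fun z ↦ w z.1.2 - f z.1.1
  have hF : StronglyMeasurable F := by
    refine StronglyMeasurable.indicator ?_ ?_
    · exact (hwm.comp_measurable (by fun_prop)).sub (hf.comp_measurable (by fun_prop))
    · exact (show Measurable fun z : (ℝ × ℝ) × E ↦ (z.1.2, z.2) by fun_prop) hC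
  have hm : Measurable fun ω ↦ ((X ω, Y ω), R ω) := by fun_prop
  have hFint : Integrable (fun ω ↦ F ((X ω, Y ω), R ω)) Q := (hwY.sub hfX).indicator hmeasA
  have hlaw := hind.map_prod_eq_prod_map_map (by fun_prop) hR.aemeasurable
  have hFint' := (integrable_map_measure hF.aestronglyMeasurable hm.aemeasurable).2 hFint
  have := Measure.isProbabilityMeasure_map (μ := Q) hR.aemeasurable
  have := Measure.isProbabilityMeasure_map (μ := Q) (hX.prodMk hY).aemeasurable
  calc ∫ ω, {ω | (Y ω, R ω) ∈ C}.indicator (fun ω ↦ w (Y ω) - f (X ω)) ω ∂Q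
      = ∫ ω, F ((X ω, Y ω), R ω) ∂Q := rfl
    _ = ∫ z, F z ∂((Q.map fun ω ↦ (X ω, Y ω)).prod (Q.map R)) := by
        rw [← hlaw, integral_map hm.aemeasurable hF.aestronglyMeasurable]
    _ = ∫ r, ∫ z, F (z, r) ∂(Q.map fun ω ↦ (X ω, Y ω)) ∂(Q.map R) :=
        integral_prod_symm _ (hlaw ▸ hFint')
    _ = ∫ r, 0 ∂(Q.map R) := by
        congr 1
        funext r
        have hD : MeasurableSet {y | (y, r) ∈ C} := measurable_prodMk_right hC
        rw [integral_map (by fun_prop)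
          (by exact (hF.comp_measurable measurable_prodMk_right).aestronglyMeasurable), ← hzero hD,
          ← integral_indicator (hY hD)]
        rfl
    _ = 0 := by simp

/-- If, up to null sets, every finite part of the family `ξ` is a function of `Y` and of a random
variable independent of `(X, Y)`, then the conditional law of `X` given the family `ξ` is its
conditional law given `Y`. -/
lemma condExp_iSup_comap_ae_eq {ι : Type*} {ξ : ι → Ω → ℝ} {S : Set ι} {t : ι} (ht : t ∈ S)
    (hX : Measurable X) (hξ : ∀ s, Measurable (ξ s))
    (hfac : ∀ I : Finset ι, (I : Set ι) ⊆ S → ∃ R : Ω → ℕ → ℝ, Measurable R ∧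
      IndepFun (fun ω ↦ (X ω, ξ t ω)) R Q ∧ ∃ g : ι → ℝ × (ℕ → ℝ) → ℝ, (∀ s, Measurable (g s)) ∧
        ∀ s ∈ I, ∀ᵐ ω ∂Q, ξ s ω = g s (ξ t ω, R ω))
    (hf : StronglyMeasurable f) (hfX : Integrable (fun ω ↦ f (X ω)) Q) :
    Q[fun ω ↦ f (X ω) | ⨆ s ∈ S, MeasurableSpace.comap (ξ s) inferInstance] =ᵐ[Q]
      fun ω ↦ ∫ x, f x ∂condDistrib X (ξ t) Q (ξ t ω) := by
  have hle : ⨆ s ∈ S, MeasurableSpace.comap (ξ s) inferInstance ≤ mΩ :=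
    iSup₂_le fun s _ ↦ (hξ s).comap_le
  have hwY : Integrable (fun ω ↦ ∫ x, f x ∂condDistrib X (ξ t) Q (ξ t ω)) Q :=
    integrable_condExp.congr (condExp_ae_eq_integral_condDistrib (hξ t) hX.aemeasurable hf hfX)
  refine (ae_eq_condExp_of_forall_setIntegral_eq hle hfX (fun _ _ _ ↦ hwY.integrableOn)
    (fun A hA _ ↦ ?_) ?_).symm
  -- Finite intersections of events `ξ s ⁻¹' D` form a generating π-system, so only finitely many
  -- times enter at once and `hfac` applies.
  · induction A, hA using MeasurableSpace.induction_on_inter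
      (generateFrom_piiUnionInter_measurableSet
        (fun s ↦ MeasurableSpace.comap (ξ s) inferInstance) S).symm
      (isPiSystem_piiUnionInter _ (fun s ↦ @MeasurableSpace.isPiSystem_measurableSet _
        (MeasurableSpace.comap (ξ s) inferInstance)) S) with
    | empty => simp
    | basic A hA =>
      obtain ⟨I, hIS, A', hA', rfl⟩ := hA
      obtain ⟨R, hR, hind, g, hg, hgξ⟩ := hfac I hIS
      have hA'' (s : ι) : ∃ D : Set ℝ, MeasurableSet D ∧ (s ∈ I → ξ s ⁻¹' D = A' s) := by
        by_cases hs : s ∈ I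
        · obtain ⟨D, hD, hDA⟩ := hA' s hs
          exact ⟨D, hD, fun _ ↦ hDA⟩
        · exact ⟨∅, .empty, fun h ↦ absurd h hs⟩
      choose D hD hDA using hA''
      let C : Set (ℝ × (ℕ → ℝ)) := ⋂ s ∈ I, g s ⁻¹' D s
      have hC : MeasurableSet C := I.measurableSet_biInter fun s _ ↦ hg s (hD s)
      have hAC : (⋂ s ∈ I, A' s : Set Ω) =ᵐ[Q] {ω | (ξ t ω, R ω) ∈ C} := by
        have : ∀ᵐ ω ∂Q, ∀ s ∈ I, ξ s ω = g s (ξ t ω, R ω) :=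
          (Filter.eventually_all_finset I).2 hgξ
        filter_upwards [this] with ω hω
        refine propext ?_
        simp only [C, mem_iInter, mem_preimage]
        change ω ∈ ⋂ s ∈ I, A' s ↔ _
        simp only [mem_iInter]
        refine forall₂_congr fun s hs ↦ ?_
        rw [← hDA s hs, mem_preimage, hω s hs]
      rw [setIntegral_congr_set hAC, setIntegral_congr_set hAC]
      exact setIntegral_integral_condDistrib_of_indepFun hX (hξ t) hR hind hf hfX hC
    | compl A hA ih =>
      have h1 := integral_add_compl (hle A hA) hwY
      have h2 := integral_add_compl (hle A hA) hfX
      have h3 : ∫ ω, ∫ x, f x ∂condDistrib X (ξ t) Q (ξ t ω) ∂Q = ∫ ω, f (X ω) ∂Q := by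
        rw [← integral_condExp (hξ t).comap_le (f := fun ω ↦ f (X ω))]
        exact integral_congr_ae
          (condExp_ae_eq_integral_condDistrib (hξ t) hX.aemeasurable hf hfX).symm
      have h4 := ih (measure_lt_top _ _)
      linarith
    | iUnion A hdisj hA ih =>
      rw [integral_iUnion (fun i ↦ hle _ (hA i)) hdisj hwY.integrableOn,
        integral_iUnion (fun i ↦ hle _ (hA i)) hdisj hfX.integrableOn]
      exact tsum_congr fun i ↦ ih i (measure_lt_top _ _)
  · have hwm : StronglyMeasurable fun y ↦ ∫ x, f x ∂condDistrib X (ξ t) Q y :=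
      (hf.comp_measurable measurable_snd).integral_condDistrib
    have : Measurable[⨆ s ∈ S, MeasurableSpace.comap (ξ s) inferInstance] (ξ t) :=
      Measurable.mono (comap_measurable (ξ t)) (le_iSup₂_of_le t ht le_rfl) le_rfl
    exact (hwm.comp_measurable this).aestronglyMeasurable

end CondExp

/-! ### Joint law of the present claim and the terminal value. -/

/-- The unnormalized posterior density: the numerator of `posteriorDensity`. -/
noncomputable def likelihood (m T t : ℝ) (p : ℝ → ℝ) (y x : ℝ) : ℝ :=
  (Ioi y).indicator (fun x ↦ p x * x ^ (1 - m * T) * (x - y) ^ (m * (T - t) - 1)) x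

lemma measurable_likelihood {m T t : ℝ} {p : ℝ → ℝ} (hp : Measurable p) :
    Measurable (Function.uncurry (likelihood m T t p)) := by
  have : Function.uncurry (likelihood m T t p) = {z : ℝ × ℝ | z.1 < z.2}.indicator
      (fun z ↦ p z.2 * z.2 ^ (1 - m * T) * (z.2 - z.1) ^ (m * (T - t) - 1)) := by
    funext z
    simp [Function.uncurry, likelihood, indicator]
  rw [this]
  exact Measurable.indicator (by fun_prop) (measurableSet_lt measurable_fst measurable_snd)

section JointLaw

variable {Ω : Type*} [MeasurableSpace Ω] {Q : Measure Ω} {m T t : ℝ}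
  {X B : Ω → ℝ} {p : ℝ → ℝ}

lemma map_mul_prodMk_of_betaMeasure [IsProbabilityMeasure Q] (hm : 0 < m) (ht0 : 0 < t)
    (htT : t < T) (hp : Measurable p) (hp0 : ∀ x, 0 ≤ p x) (hX : Measurable X) (hB : Measurable B)
    (hXp : Q.map X = (volume.restrict (Ioi 0)).withDensity fun x ↦ ENNReal.ofReal (p x))
    (hBlaw : Q.map B = betaMeasure (m * t) (m * (T - t))) (hind : IndepFun X B Q) :
    Q.map (fun ω ↦ (X ω * B ω, X ω)) =
      ((volume.withDensity fun y ↦ ENNReal.ofReal ((Ioi 0).indicator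
        (fun y ↦ y ^ (m * t - 1) / beta (m * t) (m * (T - t))) y)).prod
        (volume.restrict (Ioi 0))).withDensity
        (Function.uncurry fun y x ↦ ENNReal.ofReal (likelihood m T t p y x)) := by
  have ha : 0 < m * t := by positivity
  have hb : 0 < m * (T - t) := mul_pos hm (by linarith)
  have hβ := beta_pos ha hb
  have := isProbabilityMeasureBeta ha hb
  have mb := measurable_betaPDF (m * t) (m * (T - t))
  have mL : Measurable fun z : ℝ × ℝ ↦ ENNReal.ofReal (likelihood m T t p z.1 z.2) :=
    (measurable_likelihood hp).ennreal_ofReal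
  set h : ℝ → ℝ≥0∞ := fun y ↦ ENNReal.ofReal ((Ioi 0).indicator
        (fun y ↦ y ^ (m * t - 1) / beta (m * t) (m * (T - t))) y) with hdef
  have mh : Measurable h :=
    (Measurable.indicator (by fun_prop) measurableSet_Ioi).ennreal_ofReal
  have key {x c : ℝ} (hx : 0 < x) (hc0 : c ≠ 0) (hc1 : c ≠ 1) :
      ENNReal.ofReal x * (h (x * c) * ENNReal.ofReal (likelihood m T t p (x * c) x)) =
        ENNReal.ofReal (p x) * betaPDF (m * t) (m * (T - t)) c := by
    rcases lt_or_gt_of_ne hc0 with hc | hc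
    · rw [betaPDF_eq_zero_of_nonpos hc.le, hdef]
      simp [indicator_of_notMem, (mul_neg_of_pos_of_neg hx hc).le]
    rcases lt_or_gt_of_ne hc1 with hc' | hc'
    swap
    · rw [betaPDF_eq_zero_of_one_le hc'.le, likelihood, indicator_of_notMem]
      · simp
      · simp only [mem_Ioi, not_lt]
        nlinarith
    have h1c : 0 < 1 - c := by linarith
    have hpx := hp0 x
    have hxc : x * c ∈ Ioi (0 : ℝ) := mul_pos hx hc
    have hxc' : x ∈ Ioi (x * c) := by simp only [mem_Ioi]; nlinarith
    have e0 : x - x * c = x * (1 - c) := by ring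
    rw [betaPDF_of_pos_lt_one hc hc', hdef, likelihood]
    simp only [indicator_of_mem hxc, indicator_of_mem hxc']
    rw [e0, ← ENNReal.ofReal_mul (by positivity), ← ENNReal.ofReal_mul hx.le,
      ← ENNReal.ofReal_mul hpx]
    congr 1
    rw [Real.mul_rpow hx.le hc.le, Real.mul_rpow hx.le h1c.le]
    -- The Jacobian `x` and the powers of `x` split off from `x * c` and `x * (1 - c)` cancel: this
    -- is where the exponent `1 - m * T` comes from.
    have e1 : x * x ^ (m * t - 1) * x ^ (1 - m * T) * x ^ (m * (T - t) - 1) = 1 := by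
      nth_rewrite 1 [← Real.rpow_one x]
      rw [← Real.rpow_add hx, ← Real.rpow_add hx, ← Real.rpow_add hx]
      convert! Real.rpow_zero x using 2
      ring
    calc _ = (x * x ^ (m * t - 1) * x ^ (1 - m * T) * x ^ (m * (T - t) - 1)) *
          (p x * (1 / beta (m * t) (m * (T - t)) * c ^ (m * t - 1) *
            (1 - c) ^ (m * (T - t) - 1))) := by ring
      _ = _ := by rw [e1, one_mul]
  have := Measure.isProbabilityMeasure_map (μ := Q) hX.aemeasurable
  refine Measure.ext_of_lintegral _ fun F hF ↦ ?_
  have hF' : Measurable fun z : ℝ × ℝ ↦ F (z.1 * z.2, z.1) := by fun_prop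
  have hlaw := hind.map_prod_eq_prod_map_map hX.aemeasurable hB.aemeasurable
  rw [lintegral_map hF (by fun_prop),
    ← lintegral_map (f := fun z : ℝ × ℝ ↦ F (z.1 * z.2, z.1)) (g := fun ω ↦ (X ω, B ω))
      (by fun_prop) (by fun_prop), hlaw, lintegral_prod _ (by fun_prop), hXp, hBlaw,
    lintegral_withDensity_eq_lintegral_mul _ (by fun_prop)
      (by exact hF'.lintegral_prod_right'),
    lintegral_withDensity_eq_lintegral_mul _ (by exact mL) hF,
    lintegral_prod_symm _ (by exact (mL.mul hF).aemeasurable)]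
  refine setLIntegral_congr_fun measurableSet_Ioi fun x hx ↦ ?_
  have hx : 0 < x := hx
  have mL' : Measurable fun y ↦ ENNReal.ofReal (likelihood m T t p y x) :=
    mL.comp measurable_prodMk_right
  simp only [Pi.mul_apply, Function.uncurry]
  rw [lintegral_withDensity_eq_lintegral_mul _ mh (by fun_prop),
    lintegral_eq_mul_lintegral_comp_mul hx (by fun_prop), ← lintegral_const_mul _ (by fun_prop),
    betaMeasure, lintegral_withDensity_eq_lintegral_mul _ mb (by fun_prop),
    ← lintegral_const_mul _ (by fun_prop)]
  refine lintegral_congr_ae ?_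
  filter_upwards [Measure.ae_ne volume (0 : ℝ), Measure.ae_ne volume (1 : ℝ)] with c hc0 hc1
  simp only [Pi.mul_apply]
  calc _ = ENNReal.ofReal (p x) * betaPDF (m * t) (m * (T - t)) c * F (x * c, x) := by ring
    _ = _ := by rw [← key hx hc0 hc1]; ring

/-- At time `0` nothing is observed: the powers of `x` cancel and the likelihood at `y = 0` is the
prior `p`. -/
lemma map_mul_prodMk_of_ae_eq_zero (ht : t = 0) (hp : Measurable p) (hX : Measurable X)
    (hXp : Q.map X = (volume.restrict (Ioi 0)).withDensity fun x ↦ ENNReal.ofReal (p x))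
    (hB0 : ∀ᵐ ω ∂Q, B ω = 0) :
    Q.map (fun ω ↦ (X ω * B ω, X ω)) =
      ((Measure.dirac 0).prod (volume.restrict (Ioi 0))).withDensity
        (Function.uncurry fun y x ↦ ENNReal.ofReal (likelihood m T t p y x)) := by
  have mL : Measurable fun z : ℝ × ℝ ↦ ENNReal.ofReal (likelihood m T t p z.1 z.2) :=
    (measurable_likelihood hp).ennreal_ofReal
  have h0 : Q.map (fun ω ↦ (X ω * B ω, X ω)) = Q.map (fun ω ↦ ((0 : ℝ), X ω)) :=
    Measure.map_congr (by filter_upwards [hB0] with ω hω; simp [hω])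
  refine Measure.ext_of_lintegral _ fun F hF ↦ ?_
  rw [h0, lintegral_map hF (by fun_prop), ← lintegral_map (f := fun x ↦ F (0, x)) (by fun_prop) hX,
    hXp, lintegral_withDensity_eq_lintegral_mul _ (by fun_prop) (by fun_prop),
    lintegral_withDensity_eq_lintegral_mul _ (by exact mL) hF,
    lintegral_prod _ (by exact (mL.mul hF).aemeasurable),
    lintegral_dirac' _ (by exact (mL.mul hF).lintegral_prod_right')]
  refine setLIntegral_congr_fun measurableSet_Ioi fun x hx ↦ ?_
  have hx' : 0 < x := hx
  simp only [Pi.mul_apply, Function.uncurry, likelihood, indicator_of_mem hx, ht, sub_zero]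
  rw [mul_assoc (p x), ← Real.rpow_add hx']
  simp

end JointLaw

/-! ### Factorization of the past claims. -/

lemma Finset.exists_monotone_enumeration {ι : Type*} [LinearOrder ι] {K : Finset ι}
    (hK : K.Nonempty) :
    ∃ (τ : ℕ → ι) (n : ℕ), Monotone τ ∧ (∀ k < n, τ k < τ (k + 1)) ∧
      ∀ s, s ∈ K ↔ ∃ k ≤ n, τ k = s := by
  have hc := hK.card_pos
  -- The increasing enumeration of `K`, continued as a constant after the maximum.
  refine ⟨fun k ↦ K.orderEmbOfFin rfl ⟨min k (K.card - 1), by omega⟩, K.card - 1, ?_, ?_, ?_⟩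
  · intro i j hij
    exact (K.orderEmbOfFin rfl).monotone (by simp only [Fin.mk_le_mk]; omega)
  · intro k hk
    exact (K.orderEmbOfFin rfl).strictMono (by simp only [Fin.mk_lt_mk]; omega)
  · intro s
    constructor
    · intro hs
      rw [← Finset.mem_coe, ← Finset.range_orderEmbOfFin K rfl] at hs
      obtain ⟨i, rfl⟩ := hs
      have hi := i.2
      refine ⟨i, by omega, ?_⟩
      exact congrArg _ (Fin.ext (min_eq_left (by omega)))
    · rintro ⟨k, _, rfl⟩
      exact Finset.orderEmbOfFin_mem _ _ _

/-- Up to null sets, finitely many past values of the claims process are functions of its present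
value and of a random variable that is independent of the terminal and the present values. -/
lemma IsStandardGammaBridge.exists_indepFun_factorization {Ω : Type u} [MeasurableSpace Ω]
    {Q : Measure Ω} [IsProbabilityMeasure Q] {m : ℝ} {T : ℝ≥0} {X : Ω → ℝ} {β : Iic T → Ω → ℝ}
    (hβ : IsStandardGammaBridge m T β Q) (hm : 0 < m) (hT : 0 < T) (hX : Measurable X)
    (hind : IndepFun X (fun ω t ↦ β t ω) Q) {t : Iic T} (ht : (t : ℝ≥0) < T)
    (I : Finset (Iic T)) (hI : (I : Set (Iic T)) ⊆ Iic t) :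
    ∃ R : Ω → ℕ → ℝ, Measurable R ∧ IndepFun (fun ω ↦ (X ω, claimsProcess X β t ω)) R Q ∧
      ∃ g : Iic T → ℝ × (ℕ → ℝ) → ℝ, (∀ s, Measurable (g s)) ∧
        ∀ s ∈ I, ∀ᵐ ω ∂Q, claimsProcess X β s ω = g s (claimsProcess X β t ω, R ω) := by
  have hmeas := hβ.measurable
  let o : Iic T := ⟨0, mem_Iic.2 zero_le⟩
  have ho (s : Iic T) : o ≤ s := Subtype.coe_le_coe.1 (zero_le (a := (s : ℝ≥0)))
  -- Adjoining `0` and `t` makes the grid start at `0` and end at `t`.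
  obtain ⟨τ, n, hτ, hτn, hK⟩ := Finset.exists_monotone_enumeration
    (K := insert o (insert t I)) (Finset.insert_nonempty _ _)
  have hτ0 : τ 0 = o := by
    obtain ⟨k, _, hk⟩ := (hK o).1 (by simp)
    exact le_antisymm (hk ▸ hτ (Nat.zero_le k)) (ho _)
  have hτt : τ n = t := by
    obtain ⟨k, hkn, hk⟩ := (hK t).1 (by simp)
    refine le_antisymm ?_ (hk ▸ hτ hkn)
    have := (hK (τ n)).2 ⟨n, le_rfl, rfl⟩
    simp only [Finset.mem_insert] at this
    rcases this with h | h | h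
    · rw [h]; exact ho t
    · exact h.le
    · exact hI h
  have h1 := hβ.indepFun_ratios hm hT hτ (by rw [hτ0]) hτn
  rw [hτt] at h1
  let G : (Iic T → ℝ) → ℕ → ℝ := fun b k ↦ if k ≤ n then b (τ k) / b t else 0
  have hG : Measurable G := by
    refine measurable_pi_lambda _ fun k ↦ ?_
    simp only [G]
    split_ifs <;> fun_prop
  have hR : Measurable fun ω ↦ G fun s ↦ β s ω := hG.comp (measurable_pi_lambda _ hmeas)
  have hψ : Measurable fun b : Iic T → ℝ ↦ (b t, G b) := (measurable_pi_apply t).prodMk hG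
  have h2 : IndepFun X (fun ω ↦ (β t ω, G fun s ↦ β s ω)) Q := hind.comp measurable_id hψ
  have h3 := IndepFun.prodMk_indepFun hX (hmeas t) hR h2 h1.symm
  have hidx (s : Iic T) : ∃ k, s ∈ I → k ≤ n ∧ τ k = s := by
    by_cases hs : s ∈ I
    · obtain ⟨k, hk⟩ := (hK s).1 (by simp [hs])
      exact ⟨k, fun _ ↦ hk⟩
    · exact ⟨0, fun h ↦ absurd h hs⟩
  choose idx hidx using hidx
  refine ⟨_, hR, h3.comp (φ := fun z : ℝ × ℝ ↦ (z.1, z.1 * z.2)) (ψ := id) (by fun_prop)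
    measurable_id, fun s z ↦ z.1 * z.2 (idx s), fun s ↦ by fun_prop, fun s hs ↦ ?_⟩
  obtain ⟨hk, hks⟩ := hidx s hs
  have hst : s ≤ t := hI hs
  simp only [claimsProcess, G, hk, if_true, hks]
  -- For `t = 0` the ratio `b (τ k) / b t` is meaningless, but both claims vanish almost surely.
  rcases eq_or_ne (t : ℝ≥0) 0 with h0 | h0
  · have hs0 : (s : ℝ≥0) = 0 := le_antisymm (h0 ▸ Subtype.coe_le_coe.2 hst) zero_le
    filter_upwards [hβ.ae_eq_zero h0, hβ.ae_eq_zero hs0] with ω hω hω'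
    simp [hω, hω']
  · filter_upwards [hβ.ae_ne_zero hm (pos_iff_ne_zero.2 h0) ht] with ω hω
    field_simp

/-! ### Integrals against the likelihood and the posterior density. -/

section Posterior

variable {m T t y : ℝ} {p q : ℝ → ℝ}

lemma likelihood_nonneg (hq0 : ∀ x, 0 ≤ q x) (hy : 0 ≤ y) (x : ℝ) :
    0 ≤ likelihood m T t q y x := by
  refine indicator_nonneg (fun x hx ↦ ?_) x
  have hx : y < x := hx
  have := hq0 x
  have : 0 < x := hy.trans_lt hx
  have : 0 < x - y := by linarith
  positivity

/-- This allows `p` to be replaced by a measurable nonnegative version `q`; `0 ≤ y` ensures that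
only values on `(0, ∞)` matter. -/
lemma likelihood_ae_eq (hpq : ∀ᵐ x, 0 < x → p x = q x) (hy : 0 ≤ y) :
    likelihood m T t p y =ᵐ[volume] likelihood m T t q y := by
  filter_upwards [hpq] with x hx
  by_cases h : y < x
  · simp [likelihood, h, hx (hy.trans_lt h)]
  · simp [likelihood, h]

lemma integral_Ioi_eq_integral_likelihood :
    ∫ x in Ioi y, p x * x ^ (1 - m * T) * (x - y) ^ (m * (T - t) - 1) =
      ∫ x, likelihood m T t p y x :=
  (integral_indicator measurableSet_Ioi).symm

lemma posteriorDensity_eq_div (x : ℝ) :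
    posteriorDensity m T t p y x = likelihood m T t p y x / ∫ z, likelihood m T t p y z := by
  rw [posteriorDensity, integral_Ioi_eq_integral_likelihood, likelihood]
  by_cases h : x ∈ Ioi y <;> simp [h]

lemma setLIntegral_likelihood_mul (hy : 0 ≤ y) (f : ℝ → ℝ≥0∞) :
    ∫⁻ x in Ioi 0, ENNReal.ofReal (likelihood m T t q y x) * f x =
      ∫⁻ x, ENNReal.ofReal (likelihood m T t q y x) * f x := by
  rw [← lintegral_indicator measurableSet_Ioi]
  refine lintegral_congr fun x ↦ ?_
  by_cases h : 0 < x
  · rw [indicator_of_mem (mem_Ioi.2 h)]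
  · have : ¬ y < x := fun h' ↦ h (hy.trans_lt h')
    simp [likelihood, this]

lemma measurable_likelihood_right (hq : Measurable q) : Measurable (likelihood m T t q y) :=
  (measurable_likelihood hq).of_uncurry_left

lemma integrable_likelihood (hq : Measurable q) (hq0 : ∀ x, 0 ≤ q x)
    (hpq : ∀ᵐ x, 0 < x → p x = q x) (hy : 0 ≤ y)
    (htop : ∫⁻ x in Ioi 0, ENNReal.ofReal (likelihood m T t q y x) ≠ ∞) :
    Integrable (likelihood m T t p y) := by
  have h := setLIntegral_likelihood_mul (m := m) (T := T) (t := t) (q := q) hy 1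
  simp only [Pi.one_apply, mul_one] at h
  rw [h, lintegral_ofReal_ne_top_iff_integrable
    (measurable_likelihood_right hq).aestronglyMeasurable
    (ae_of_all _ (likelihood_nonneg hq0 hy))] at htop
  exact htop.congr (likelihood_ae_eq hpq hy).symm

lemma integrable_likelihood_mul (hq : Measurable q) (hq0 : ∀ x, 0 ≤ q x)
    (hpq : ∀ᵐ x, 0 < x → p x = q x) (hy : 0 ≤ y)
    (htop : ∫⁻ x in Ioi 0, ENNReal.ofReal (likelihood m T t q y x) * ENNReal.ofReal x ≠ ∞) :
    Integrable (fun x ↦ likelihood m T t p y x * x) := by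
  have hnn (x : ℝ) : 0 ≤ likelihood m T t q y x * x := by
    by_cases h : y < x
    · exact mul_nonneg (likelihood_nonneg hq0 hy x) (hy.trans h.le)
    · simp [likelihood, h]
  rw [setLIntegral_likelihood_mul hy] at htop
  simp only [← ENNReal.ofReal_mul (likelihood_nonneg hq0 hy _)] at htop
  rw [lintegral_ofReal_ne_top_iff_integrable
    (by exact ((measurable_likelihood_right hq).mul measurable_id).aestronglyMeasurable)
    (ae_of_all _ hnn)] at htop
  refine htop.congr ?_
  filter_upwards [likelihood_ae_eq (m := m) (T := T) (t := t) hpq hy] with x hx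
  rw [hx]

lemma ofReal_integral_likelihood (hq : Measurable q) (hq0 : ∀ x, 0 ≤ q x)
    (hpq : ∀ᵐ x, 0 < x → p x = q x) (hy : 0 ≤ y)
    (htop : ∫⁻ x in Ioi 0, ENNReal.ofReal (likelihood m T t q y x) ≠ ∞) :
    ENNReal.ofReal (∫ x, likelihood m T t p y x) =
      ∫⁻ x in Ioi 0, ENNReal.ofReal (likelihood m T t q y x) := by
  have h := setLIntegral_likelihood_mul (m := m) (T := T) (t := t) (q := q) hy 1
  simp only [Pi.one_apply, mul_one] at h
  rw [h, integral_congr_ae (likelihood_ae_eq hpq hy), ofReal_integral_eq_lintegral_ofReal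
    (integrable_likelihood hq hq0 (ae_of_all _ fun _ _ ↦ rfl) hy htop)
    (ae_of_all _ (likelihood_nonneg hq0 hy))]

lemma withDensity_posteriorDensity (hpq : ∀ᵐ x, 0 < x → p x = q x) (hy : 0 ≤ y)
    (hZ : 0 < ∫ x, likelihood m T t p y x) :
    volume.withDensity (fun x ↦ ENNReal.ofReal (posteriorDensity m T t p y x)) =
      (volume.restrict (Ioi 0)).withDensity (fun x ↦
        (ENNReal.ofReal (∫ x, likelihood m T t p y x))⁻¹ *
          ENNReal.ofReal (likelihood m T t q y x)) := by
  rw [← withDensity_indicator measurableSet_Ioi]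
  refine withDensity_congr_ae ?_
  filter_upwards [likelihood_ae_eq (m := m) (T := T) (t := t) hpq hy] with x hx
  rw [posteriorDensity_eq_div, hx, ENNReal.ofReal_div_of_pos hZ, ENNReal.div_eq_inv_mul]
  by_cases h : 0 < x
  · rw [indicator_of_mem (mem_Ioi.2 h)]
  · have : ¬ y < x := fun h' ↦ h (hy.trans_lt h')
    rw [indicator_of_notMem (by simpa using h)]
    simp [likelihood, this]

lemma integral_withDensity_posteriorDensity (hq : Measurable q) (hq0 : ∀ x, 0 ≤ q x)
    (hpq : ∀ᵐ x, 0 < x → p x = q x) (hy : 0 ≤ y)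
    (hZ : 0 < ∫ x, likelihood m T t p y x) (f : ℝ → ℝ) :
    ∫ x, f x ∂volume.withDensity (fun x ↦ ENNReal.ofReal (posteriorDensity m T t p y x)) =
      ∫ x, posteriorDensity m T t p y x * f x := by
  have hae : posteriorDensity m T t p y =ᵐ[volume]
      fun x ↦ likelihood m T t q y x / ∫ z, likelihood m T t p y z := by
    filter_upwards [likelihood_ae_eq (m := m) (T := T) (t := t) hpq hy] with x hx
    rw [posteriorDensity_eq_div, hx]
  have hm : AEMeasurable (posteriorDensity m T t p y) :=
    ⟨_, (measurable_likelihood_right hq).div_const _, hae⟩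
  rw [integral_withDensity_eq_integral_toReal_smul₀ hm.ennreal_ofReal
    (ae_of_all _ fun _ ↦ ENNReal.ofReal_lt_top)]
  refine integral_congr_ae ?_
  filter_upwards [hae] with x hx
  rw [ENNReal.toReal_ofReal, smul_eq_mul]
  rw [hx]
  exact div_nonneg (likelihood_nonneg hq0 hy x) hZ.le

/-- Since `x ^ (2 - m * T) = x ^ (1 - m * T) * x`, the numerator of the reserve is the first moment
of the likelihood. -/
lemma indicator_Ioi_eq_likelihood_mul (hy : 0 ≤ y) (x : ℝ) :
    (Ioi y).indicator (fun x ↦ p x * x ^ (2 - m * T) * (x - y) ^ (m * (T - t) - 1)) x =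
      likelihood m T t p y x * x := by
  by_cases h : y < x
  · have hx : 0 < x := hy.trans_lt h
    rw [likelihood, indicator_of_mem (mem_Ioi.2 h), indicator_of_mem (mem_Ioi.2 h),
      show 2 - m * T = (1 - m * T) + 1 by ring, Real.rpow_add_one hx.ne']
    ring
  · simp [likelihood, h]

end Posterior

/-! ### Assembly. -/

lemma IsStandardGammaBridge.ae_nonneg {Ω : Type u} [MeasurableSpace Ω] {Q : Measure Ω}
    {m : ℝ} {T : ℝ≥0} {β : Iic T → Ω → ℝ} (hβ : IsStandardGammaBridge m T β Q) (hm : 0 < m)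
    {t : Iic T} (ht : (t : ℝ≥0) < T) : ∀ᵐ ω ∂Q, 0 ≤ β t ω := by
  rcases eq_or_ne (t : ℝ≥0) 0 with h0 | h0
  · filter_upwards [hβ.ae_eq_zero h0] with ω hω using hω.ge
  · have h : ∀ᵐ x ∂Q.map (β t), 0 ≤ x := by
      rw [hβ.map_eq_betaMeasure hm (pos_iff_ne_zero.2 h0) ht, betaMeasure,
        ae_withDensity_iff (measurable_betaPDF _ _)]
      refine ae_of_all _ fun x hx ↦ ?_
      by_contra hneg
      exact hx (betaPDF_eq_zero_of_nonpos (not_le.1 hneg).le)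
    exact ae_of_ae_map (hβ.measurable t).aemeasurable h

/-- The reference measure `μ` can stay unspecified because it does not appear in Bayes' formula;
this treats `t = 0` and `t > 0` together. -/
lemma IsStandardGammaBridge.exists_map_claimsProcess_prodMk {Ω : Type u} [MeasurableSpace Ω]
    {Q : Measure Ω} [IsProbabilityMeasure Q] {m : ℝ} {T : ℝ≥0} {X : Ω → ℝ} {β : Iic T → Ω → ℝ}
    (hβ : IsStandardGammaBridge m T β Q) (hm : 0 < m) (hX : Measurable X)
    {q : ℝ → ℝ} (hq : Measurable q) (hq0 : ∀ x, 0 ≤ q x)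
    (hXq : Q.map X = (volume.restrict (Ioi 0)).withDensity fun x ↦ ENNReal.ofReal (q x))
    (hind : IndepFun X (fun ω t ↦ β t ω) Q) {t : Iic T} (ht : (t : ℝ≥0) < T) :
    ∃ μ : Measure ℝ, SFinite μ ∧ Q.map (fun ω ↦ (claimsProcess X β t ω, X ω)) =
      (μ.prod (volume.restrict (Ioi 0))).withDensity
        (Function.uncurry fun y x ↦ ENNReal.ofReal (likelihood m T t q y x)) := by
  rcases eq_or_ne (t : ℝ≥0) 0 with h0 | h0
  · exact ⟨_, inferInstance, map_mul_prodMk_of_ae_eq_zero (by simp [h0]) hq hX hXq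
      (hβ.ae_eq_zero h0)⟩
  · have h0 := pos_iff_ne_zero.2 h0
    exact ⟨_, inferInstance, map_mul_prodMk_of_betaMeasure hm h0 ht hq hq0 hX (hβ.measurable t)
      hXq (hβ.map_eq_betaMeasure hm h0 ht) (hind.comp measurable_id (measurable_pi_apply t))⟩

theorem proposition5 {Ω : Type u} [MeasurableSpace Ω] (Q : Measure Ω) [IsProbabilityMeasure Q]
    (m : ℝ) (hm : 0 < m) (T : ℝ≥0) (hT : 0 < T) (P : ℝ≥0 → ℝ≥0 → ℝ)
    (X : Ω → ℝ) (hX : Measurable X) (hXint : Integrable X Q)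
    (p : ℝ → ℝ) (hp : AEMeasurable p (volume.restrict (Ioi 0))) (hp0 : ∀ x, 0 < x → 0 ≤ p x)
    (hXp : HasLaw X ((volume.restrict (Ioi 0)).withDensity (fun x ↦ ENNReal.ofReal (p x))) Q)
    (β : Iic T → Ω → ℝ) (hβ : IsStandardGammaBridge m T β Q)
    (hind : IndepFun X (fun ω t ↦ β t ω) Q)
    (ξ : Iic T → Ω → ℝ) (hξ : ξ = claimsProcess X β)
    (t : Iic T) (ht : (t : ℝ≥0) < T) :
    -- almost surely, both integrals converge and the denominator is positive
    (∀ᵐ ω ∂Q,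
      IntegrableOn (fun x ↦ p x * x ^ (2 - m * T) * (x - ξ t ω) ^ (m * (T - t) - 1))
        (Ioi (ξ t ω)) ∧
      IntegrableOn (fun x ↦ p x * x ^ (1 - m * T) * (x - ξ t ω) ^ (m * (T - t) - 1))
        (Ioi (ξ t ω)) ∧
      0 < ∫ x in Ioi (ξ t ω), p x * x ^ (1 - m * T) * (x - ξ t ω) ^ (m * (T - t) - 1)) ∧
    -- the value process
    (∀ᵐ ω ∂Q, valueProcess Q P X ξ t ω =
      P t T *
        ((∫ x in Ioi (ξ t ω), p x * x ^ (2 - m * T) * (x - ξ t ω) ^ (m * (T - t) - 1)) /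
          ∫ x in Ioi (ξ t ω), p x * x ^ (1 - m * T) * (x - ξ t ω) ^ (m * (T - t) - 1))) ∧
    -- `π_t` is the density of the conditional law of `X` given `ξ_t`
    (∀ᵐ ω ∂Q, condDistrib X (ξ t) Q (ξ t ω) =
      volume.withDensity (fun x ↦ ENNReal.ofReal (posteriorDensity m T t p (ξ t ω) x))) ∧
    -- `π_t` is also the density of the conditional law of `X` given the history up to time `t`
    (∀ B : Set ℝ, MeasurableSet B → ∀ᵐ ω ∂Q, (Q⟦X ⁻¹' B | historySigma ξ t⟧) ω =
      ∫ x in B, posteriorDensity m T t p (ξ t ω) x) := by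
  subst hξ
  -- `p` is only almost everywhere measurable on `(0, ∞)` and arbitrary elsewhere, so the measure
  -- theory is done with `q`.
  let q : ℝ → ℝ := fun x ↦ max (hp.mk p x) 0
  have hq : Measurable q := hp.measurable_mk.max measurable_const
  have hq0 (x : ℝ) : 0 ≤ q x := le_max_right _ _
  have hpq : ∀ᵐ x, 0 < x → p x = q x := by
    filter_upwards [(ae_restrict_iff' measurableSet_Ioi).1 hp.ae_eq_mk] with x hx hx0
    simp only [q]
    rw [← hx hx0, max_eq_left (hp0 x hx0)]
  have hXq : Q.map X = (volume.restrict (Ioi 0)).withDensity fun x ↦ ENNReal.ofReal (q x) := by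
    rw [hXp.map_eq]
    refine withDensity_congr_ae ((ae_restrict_iff' measurableSet_Ioi).2 ?_)
    filter_upwards [hpq] with x hx hx0
    rw [hx hx0]
  have hXpos : ∀ᵐ ω ∂Q, 0 < X ω := by
    have h : ∀ᵐ x ∂Q.map X, 0 < x := by
      rw [hXq]
      exact (withDensity_absolutelyContinuous _ _).ae_le (ae_restrict_mem measurableSet_Ioi)
    exact ae_of_ae_map hX.aemeasurable h
  have hY : ∀ s, Measurable (claimsProcess X β s) := fun s ↦ hX.mul (hβ.measurable s)
  obtain ⟨μ, _, hjoint⟩ := hβ.exists_map_claimsProcess_prodMk hm hX hq hq0 hXq hind ht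
  have hk : Measurable (Function.uncurry fun y x ↦ ENNReal.ofReal (likelihood m T t q y x)) :=
    (measurable_likelihood hq).ennreal_ofReal
  have hac := absolutelyContinuous_of_map_prodMk hX hk hjoint
  have hnn : ∀ᵐ ω ∂Q, 0 ≤ claimsProcess X β t ω := by
    filter_upwards [hXpos, hβ.ae_nonneg hm ht] with ω h1 h2 using mul_nonneg h1.le h2
  -- Used with `f = 1` for the denominator and with `f = ENNReal.ofReal`, by integrability of `X`,
  -- for the numerator.
  have hfin {f : ℝ → ℝ≥0∞} (hf : Measurable f) (hfX : ∫⁻ ω, f (X ω) ∂Q ≠ ∞) :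
      ∀ᵐ ω ∂Q, ∫⁻ x in Ioi 0,
        ENNReal.ofReal (likelihood m T t q (claimsProcess X β t ω) x) * f x < ∞ :=
    ae_of_ae_map (hY t).aemeasurable
      (hac.ae_le (ae_lintegral_mul_lt_top_of_map_prodMk hX (hY t) hk hjoint hf hfX))
  have hgood : ∀ᵐ ω ∂Q, Integrable (likelihood m T t p (claimsProcess X β t ω)) ∧
      Integrable (fun x ↦ likelihood m T t p (claimsProcess X β t ω) x * x) ∧
      0 < ∫ x, likelihood m T t p (claimsProcess X β t ω) x := by
    filter_upwards [hnn, hfin (f := 1) measurable_one (by simp),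
      hfin ENNReal.measurable_ofReal hXint.lintegral_lt_top.ne,
      ae_pos_of_map_prodMk hX (hY t) hk hjoint] with ω hy h1 hx hpos
    simp only [Pi.one_apply, mul_one] at h1
    refine ⟨integrable_likelihood hq hq0 hpq hy h1.ne,
      integrable_likelihood_mul hq hq0 hpq hy hx.ne, ?_⟩
    rw [← ofReal_integral_likelihood hq hq0 hpq hy h1.ne] at hpos
    simpa using hpos
  have hcond : ∀ᵐ ω ∂Q, condDistrib X (claimsProcess X β t) Q (claimsProcess X β t ω) =
      volume.withDensity (fun x ↦
        ENNReal.ofReal (posteriorDensity m T t p (claimsProcess X β t ω) x)) := by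
    filter_upwards [hnn, hfin (f := 1) measurable_one (by simp), hgood,
      condDistrib_ae_eq_withDensity hX (hY t) hk hjoint] with ω hy h1 hg hω
    simp only [Pi.one_apply, mul_one] at h1
    rw [hω, withDensity_posteriorDensity hpq hy hg.2.2,
      ofReal_integral_likelihood hq hq0 hpq hy h1.ne]
  have hcondExp {f : ℝ → ℝ} (hf : StronglyMeasurable f) (hfX : Integrable (fun ω ↦ f (X ω)) Q) :
      ∀ᵐ ω ∂Q, (Q[fun ω ↦ f (X ω) | historySigma (claimsProcess X β) t]) ω =
        ∫ x, posteriorDensity m T t p (claimsProcess X β t ω) x * f x := by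
    have h := condExp_iSup_comap_ae_eq (S := Iic t) (mem_Iic.2 le_rfl) hX hY
      (hβ.exists_indepFun_factorization hm hT hX hind ht) hf hfX
    filter_upwards [h, hcond, hnn, hgood] with ω hω hc hy hg
    rw [← integral_withDensity_posteriorDensity hq hq0 hpq hy hg.2.2, ← hc]
    exact hω
  refine ⟨?_, ?_, hcond, fun B hB ↦ ?_⟩
  · filter_upwards [hnn, hgood] with ω hy hg
    refine ⟨?_, (integrable_indicator_iff measurableSet_Ioi).1 hg.1, ?_⟩
    · refine (integrable_indicator_iff measurableSet_Ioi).1 ?_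
      simpa only [← indicator_Ioi_eq_likelihood_mul hy] using hg.2.1
    · rw [integral_Ioi_eq_integral_likelihood]
      exact hg.2.2
  · filter_upwards [hnn, hcondExp stronglyMeasurable_id hXint] with ω hy hω
    rw [valueProcess]
    congr 1
    refine hω.trans ?_
    rw [integral_Ioi_eq_integral_likelihood, ← integral_indicator measurableSet_Ioi]
    simp only [indicator_Ioi_eq_likelihood_mul hy, posteriorDensity_eq_div, id, div_mul_eq_mul_div]
    rw [integral_div]
  · have hf : StronglyMeasurable (B.indicator fun _ ↦ (1 : ℝ)) :=
      stronglyMeasurable_const.indicator hB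
    filter_upwards [hcondExp hf ((integrable_const (1 : ℝ)).indicator (hX hB))] with ω hω
    refine hω.trans ?_
    rw [← integral_indicator hB]
    congr 1
    funext x
    by_cases h : x ∈ B <;> simp [h]
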